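/- For $|\rho|\le 1$ let $\Sigma_\rho=\begin{bmatrix}1&\rho\\ \rho&1\end{bmatrix}$. For $n\in\mathbb N$ consider testing, from $\mathsf X=(X_1,\dots,X_n)\in\mathbb R^n$ and $\mathsf Y=(Y_1,\dots,Y_n)\in\mathbb R^n$, \[ \mathcal H_0:\ (X_1,Y_1),\dots,(X_n,Y_n)\overset{\text{i.i.d.}}{\sim}\mathcal N(\mathbf 0,\Sigma_0) \qquad\text{against}\qquad \mathcal H_1:\ (X_1,Y_{\sigma(1)}),\dots,(X_n,Y_{\sigma(n)})\overset{\text{i.i.d.}}{\sim}\mathcal N(\mathbf 0,\Sigma_\rho)\ \text{given }\sigma, \] where $\sigma$ is a uniformly random permutation of $\{1,\dots,n\}$. Let $\mathbb P_{\mathcal H_0}$ and $\mathbb P_{\mathcal H_1}$ be the laws of $(\mathsf X,\mathsf Y)$ under the two hypotheses, the second one averaged over $\sigma$, and let \[ \mathsf R^\star=\mathsf R^\star(\rho,n)=\inf_{\phi}\Big(\mathbb P_{\mathcal H_0}[\phi(\mathsf X,\mathsf Y)=1]+\mathbb P_{\mathcal H_1}[\phi(\mathsf X,\mathsf Y)=0]\Big)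 \] be the optimal Bayes risk, the infimum being over all measurable tests $\phi:\mathbb R^n\times\mathbb R^n\to\{0,1\}$. Theorem (impossibility of strong detection). Let $(\rho_k,n_k)_{k\in\mathbb N}$ be any sequence with $|\rho_k|\le1$, $n_k\in\mathbb N$ and $\rho_k^2=1-\Omega(1)$, that is, there is $\varepsilon>0$ with $\rho_k^2\le 1-\varepsilon$ for all $k$. Then $\mathsf R^\star(\rho_k,n_k)=\Omega(1)$, that is, there is $c>0$ with $\mathsf R^\star(\rho_k,n_k)\ge c$ for all $k$. In particular, strong detection is impossible: $\mathsf R^\star(\rho_k,n_k)$ does not converge to $0$ as $k\to\infty$. -/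

import Mathlib

open MeasureTheory ProbabilityTheory Filter Topology

noncomputable section

namespace PermutedCorrelation

/-- The covariance matrix `Σ_ρ` with unit variances and correlation `ρ`. -/
def corrMatrix (ρ : ℝ) : Matrix (Fin 2) (Fin 2) ℝ := !![1, ρ; ρ, 1]

/-- The bivariate normal distribution `N(0, Σ_ρ)`. -/
def pairLaw (ρ : ℝ) : Measure (EuclideanSpace ℝ (Fin 2)) :=
  multivariateGaussian 0 (corrMatrix ρ)

/-- The observation space `ℝⁿ × ℝⁿ` of the pair `(X, Y)`. -/
abbrev Obs (n : ℕ) : Type := (Fin n → ℝ) × (Fin n → ℝ)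

/-- The observation `(X, Y)` for which the matched pairs `(X_i, Y_{σ(i)})` are the given `z i`,
that is, `X_i = (z i)_0` and `Y_{σ(i)} = (z i)_1`. -/
def unmatch {n : ℕ} (σ : Equiv.Perm (Fin n)) (z : Fin n → EuclideanSpace ℝ (Fin 2)) : Obs n :=
  (fun i => z i 0, fun j => z (σ.symm j) 1)

/-- The law of `(X, Y)` under the null hypothesis: `(X_1, Y_1), …, (X_n, Y_n)` are i.i.d. with
law `N(0, Σ_0)`. -/
def nullLaw (n : ℕ) : Measure (Obs n) :=
  (Measure.pi fun _ : Fin n => pairLaw 0).map (unmatch 1)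

/-- The law of `(X, Y)` under the alternative given the permutation `σ`:
`(X_1, Y_{σ(1)}), …, (X_n, Y_{σ(n)})` are i.i.d. with law `N(0, Σ_ρ)`. -/
def altLawGiven (n : ℕ) (ρ : ℝ) (σ : Equiv.Perm (Fin n)) : Measure (Obs n) :=
  (Measure.pi fun _ : Fin n => pairLaw ρ).map (unmatch σ)

/-- The law of `(X, Y)` under the alternative: the average of `altLawGiven n ρ σ` over a
uniformly random permutation `σ`. -/
def altLaw (n : ℕ) (ρ : ℝ) : Measure (Obs n) :=
  (n.factorial : ENNReal)⁻¹ • ∑ σ : Equiv.Perm (Fin n), altLawGiven n ρ σ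

/-- The risk of a test: the sum of its Type-I and Type-II error probabilities. -/
def risk (n : ℕ) (ρ : ℝ) (φ : Obs n → Fin 2) : ℝ :=
  (nullLaw n).real {p | φ p = 1} + (altLaw n ρ).real {p | φ p = 0}

/-- The optimal Bayes risk: the infimum of the risk over all (measurable) tests. -/
def bayesRisk (n : ℕ) (ρ : ℝ) : ℝ :=
  ⨅ φ : {φ : Obs n → Fin 2 // Measurable φ}, risk n ρ φ.1

/-- `f = Ω(g)` for real sequences: `g ≤ C f` for some constant `C > 0`, at every index. -/
def IsBigOmega (f g : ℕ → ℝ) : Prop := ∃ C : ℝ, 0 < C ∧ ∀ k, g k ≤ C * f k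

/-- The sequence `(ρ_k, n_k)` is admissible for strong detection. -/
def StrongDetection (ρ : ℕ → ℝ) (n : ℕ → ℕ) : Prop :=
  Tendsto (fun k => bayesRisk (n k) (ρ k)) atTop (𝓝 0)

end PermutedCorrelation

end

/-!
Conditionally on `σ`, the likelihood ratio of the alternative against the null is
`∏ i, M_ρ (X_i, Y_{σ(i)})`, where `M_ρ` is the Mehler kernel. The Mehler kernels satisfy
`M_a ∘ M_b = M_{ab}` on `L²(N(0, 1))` and `M_a` has trace `1 / (1 - a)`. Hence integrating out `Y`
and then `X` turns the inner product of the likelihood ratios of `σ` and `τ` into a product of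
traces of powers of `M_{ρ²}`, one for each cycle of `τ⁻¹σ`. The diagonal matrices
`diag (1, a, a², …)` have the same composition rule and the same traces, so this product is also the
sum of `ρ ^ (2 ∑ i, k i)` over the tuples `k ∈ ℕⁿ` that are fixed by `τ⁻¹σ`.

A tuple is fixed by as many permutations as there are permutations that sort it. The average over
the permutations is therefore the sum over the nondecreasing tuples, and the second moment of the
averaged likelihood ratio is exactly `∏_{j = 1}^n (1 - ρ ^ (2j))⁻¹`. It is bounded uniformly in `n`
as long as `ρ²` stays away from `1`, and by the Cauchy–Schwarz inequality a bounded second moment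
keeps the two error probabilities of a test from being small simultaneously.
-/

namespace PermutedCorrelation

open scoped ENNReal

section Tuples

lemma monotone_fin_cons {α : Type*} [Preorder α] {n : ℕ} {a : α} {f : Fin n → α}
    (ha : ∀ i, a ≤ f i) (hf : Monotone f) : Monotone (Fin.cons a f : Fin (n + 1) → α) := by
  intro i j hij
  induction i using Fin.cases with
  | zero => induction j using Fin.cases <;> simp [ha]
  | succ i =>
    induction j using Fin.cases with
    | zero => simp at hij
    | succ j => simpa using hf (Fin.succ_le_succ_iff.1 hij)

lemma monotone_succ_sub_zero {n : ℕ} (k : Fin (n + 1) →o ℕ) :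
    Monotone fun i : Fin n => k i.succ - k 0 := fun _ _ hij =>
  Nat.sub_le_sub_right (k.monotone (Fin.succ_le_succ_iff.2 hij)) _

/-- A nondecreasing `(n + 1)`-tuple as its first entry `m` together with the nondecreasing
`n`-tuple of the other entries minus `m`; this is the step of the recursion for the generating
function of nondecreasing tuples. -/
def orderHomFinSuccEquiv (n : ℕ) : ℕ × (Fin n →o ℕ) ≃ (Fin (n + 1) →o ℕ) where
  toFun p := ⟨Fin.cons p.1 fun i => p.2 i + p.1,
    monotone_fin_cons (fun _ => Nat.le_add_left _ _) (p.2.monotone.add_const p.1)⟩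
  invFun k := (k 0, ⟨fun i => k i.succ - k 0, monotone_succ_sub_zero k⟩)
  left_inv p := by ext <;> simp
  right_inv k := by
    ext i
    induction i using Fin.cases with
    | zero => simp
    | succ i => simpa using Nat.sub_add_cancel (k.monotone (Fin.zero_le i.succ))

lemma tsum_orderHom_pow_sum (n : ℕ) (q : ℝ≥0∞) :
    ∑' k : Fin n →o ℕ, q ^ ∑ i, k i = ∏ j ∈ Finset.range n, (1 - q ^ (j + 1))⁻¹ := by
  induction n with
  | zero =>
    have : Unique (Fin 0 →o ℕ) := ⟨⟨⊥⟩, fun _ => OrderHom.ext _ _ (Subsingleton.elim _ _)⟩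
    simp
  | succ n ih =>
    calc ∑' k : Fin (n + 1) →o ℕ, q ^ ∑ i, k i
        = ∑' p : ℕ × (Fin n →o ℕ), (q ^ (n + 1)) ^ p.1 * q ^ ∑ i, p.2 i := by
          rw [← (orderHomFinSuccEquiv n).tsum_eq]
          refine tsum_congr fun p => ?_
          rw [← pow_mul, ← pow_add]
          simp only [orderHomFinSuccEquiv, Equiv.coe_fn_mk, OrderHom.coe_mk, Fin.sum_univ_succ,
            Fin.cons_zero, Fin.cons_succ, Finset.sum_add_distrib, Finset.sum_const,
            Finset.card_univ, Fintype.card_fin, smul_eq_mul]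
          ring
      _ = (∑' m : ℕ, (q ^ (n + 1)) ^ m) * ∑' k : Fin n →o ℕ, q ^ ∑ i, k i := by
          rw [ENNReal.tsum_prod (f := fun m (k : Fin n →o ℕ) => (q ^ (n + 1)) ^ m * q ^ ∑ i, k i)]
          simp_rw [ENNReal.tsum_mul_left, ENNReal.tsum_mul_right]
      _ = ∏ j ∈ Finset.range (n + 1), (1 - q ^ (j + 1))⁻¹ := by
          rw [ENNReal.tsum_geometric, ih, Finset.prod_range_succ, mul_comm]

variable {α : Type*} [LinearOrder α] {n : ℕ}

open Classical in
lemma card_comp_eq_self_eq_card_monotone_comp (k : Fin n → α) :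
    (Finset.univ.filter fun σ : Equiv.Perm (Fin n) => k ∘ σ = k).card =
      (Finset.univ.filter fun σ : Equiv.Perm (Fin n) => Monotone (k ∘ σ)).card := by
  refine Finset.card_equiv (Equiv.mulRight (Tuple.sort k)) fun σ => ?_
  simp only [Finset.mem_filter, Finset.mem_univ, true_and, Equiv.coe_mulRight]
  rw [← Tuple.comp_sort_eq_comp_iff_monotone, Equiv.Perm.coe_mul, ← Function.comp_assoc]
  exact ((Tuple.sort k).surjective.injective_comp_right.eq_iff).symm

open Classical in
lemma tsum_ite_monotone (w : (Fin n → α) → ℝ≥0∞) :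
    ∑' k, (if Monotone k then w k else 0) = ∑' k : Fin n →o α, w k := by
  rw [← (DFunLike.coe_injective (F := Fin n →o α)).tsum_eq]
  · simp [OrderHom.monotone]
  · intro k hk
    have hk : Monotone k := by by_contra h; simp [h] at hk
    exact ⟨⟨k, hk⟩, rfl⟩

lemma sum_perm_tsum_ite_comp_eq_self {w : (Fin n → α) → ℝ≥0∞}
    (hw : ∀ k (σ : Equiv.Perm (Fin n)), w (k ∘ σ) = w k) :
    ∑ σ : Equiv.Perm (Fin n), ∑' k : Fin n → α, (if k ∘ σ = k then w k else 0) =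
      n.factorial * ∑' k : Fin n →o α, w k := by
  classical
  calc ∑ σ : Equiv.Perm (Fin n), ∑' k : Fin n → α, (if k ∘ σ = k then w k else 0)
      = ∑' k : Fin n → α, ∑ σ : Equiv.Perm (Fin n), (if k ∘ σ = k then w k else 0) :=
        (Summable.tsum_finsetSum fun _ _ => ENNReal.summable).symm
    _ = ∑' k : Fin n → α, ∑ σ : Equiv.Perm (Fin n), (if Monotone (k ∘ σ) then w k else 0) := by
        refine tsum_congr fun k => ?_
        rw [← Finset.sum_filter, ← Finset.sum_filter, Finset.sum_const, Finset.sum_const,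
          card_comp_eq_self_eq_card_monotone_comp]
    _ = ∑ σ : Equiv.Perm (Fin n), ∑' k : Fin n → α,
          (if Monotone (k ∘ σ) then w (k ∘ σ) else 0) := by
        simp_rw [hw]
        exact Summable.tsum_finsetSum fun _ _ => ENNReal.summable
    _ = ∑ _σ : Equiv.Perm (Fin n), ∑' k : Fin n →o α, w k := by
        refine Finset.sum_congr rfl fun σ _ => ?_
        rw [← tsum_ite_monotone]
        exact (Equiv.arrowCongr σ.symm (Equiv.refl α)).tsum_eq
          fun k => if Monotone k then w k else 0
    _ = n.factorial * ∑' k : Fin n →o α, w k := by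
        simp [Fintype.card_perm]

end Tuples

section ProductMeasures

variable {ι : Type*} [Fintype ι] {X : ι → Type*} [∀ i, MeasurableSpace (X i)]
  {μ : ∀ i, Measure (X i)} [∀ i, IsProbabilityMeasure (μ i)] {f : ∀ i, X i → ℝ≥0∞}

lemma lintegral_pi_prod (hf : ∀ i, Measurable (f i)) :
    ∫⁻ x, ∏ i, f i (x i) ∂Measure.pi μ = ∏ i, ∫⁻ t, f i t ∂μ i := by
  rw [lintegral_prod_eq_prod_lintegral_of_indepFun Finset.univ (fun i (x : ∀ i, X i) => f i (x i))
    (iIndepFun_pi fun i => (hf i).aemeasurable) fun i => (hf i).comp (measurable_pi_apply i)]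
  exact Finset.prod_congr rfl fun i _ => (measurePreserving_eval μ i).lintegral_comp (hf i)

lemma pi_withDensity (hf : ∀ i, Measurable (f i)) [∀ i, SigmaFinite ((μ i).withDensity (f i))] :
    Measure.pi (fun i => (μ i).withDensity (f i)) =
      (Measure.pi μ).withDensity fun x => ∏ i, f i (x i) := by
  classical
  refine Measure.pi_eq fun s hs => ?_
  have hind : ∀ x : ∀ i, X i, (Set.univ.pi s).indicator (fun x => ∏ i, f i (x i)) x =
      ∏ i, (s i).indicator (f i) (x i) := fun x => by
    simp [Set.indicator_apply, Finset.prod_ite_zero]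
  rw [withDensity_apply _ (.univ_pi hs), ← lintegral_indicator (.univ_pi hs)]
  simp_rw [hind]
  rw [lintegral_pi_prod fun i => (hf i).indicator (hs i)]
  simp_rw [lintegral_indicator (hs _), withDensity_apply _ (hs _)]

lemma lintegral_pi_fin_succ {X : Type*} [MeasurableSpace X] (μ : Measure X) [SigmaFinite μ]
    {n : ℕ} {f : (Fin (n + 1) → X) → ℝ≥0∞} (hf : Measurable f) :
    ∫⁻ x, f x ∂Measure.pi (fun _ => μ) =
      ∫⁻ y, ∫⁻ t, f (Fin.cons t y) ∂μ ∂Measure.pi (fun _ : Fin n => μ) := by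
  have h := (measurePreserving_piFinSuccAbove (fun _ : Fin (n + 1) => μ) 0).symm
  rw [← h.lintegral_comp hf]
  refine (lintegral_prod_symm' _ (hf.comp h.measurable)).trans
    (lintegral_congr fun y => lintegral_congr fun t => ?_)
  exact congr_arg f (Fin.insertNth_zero' t y)

lemma withDensity_comp_map {α β : Type*} [MeasurableSpace α] [MeasurableSpace β] {μ : Measure α}
    {ν : Measure β} {T : α → β} (hT : MeasurePreserving T μ ν) {f : β → ℝ≥0∞}
    (hf : Measurable f) : (μ.withDensity (f ∘ T)).map T = ν.withDensity f := by
  ext s hs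
  rw [Measure.map_apply hT.measurable hs, withDensity_apply _ (hT.measurable hs),
    withDensity_apply _ hs]
  exact hT.setLIntegral_comp_preimage hs hf

end ProductMeasures
section Mehler

/-- The density of the normal law `N(m, v)` with respect to `N(0, 1)`, for `0 < v`. -/
noncomputable def gaussianDensityRatio (m v x : ℝ) : ℝ≥0∞ :=
  ENNReal.ofReal ((√v)⁻¹ * Real.exp (x ^ 2 / 2 - (x - m) ^ 2 / (2 * v)))

@[fun_prop]
lemma measurable_gaussianDensityRatio (m v : ℝ) : Measurable (gaussianDensityRatio m v) := by
  unfold gaussianDensityRatio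
  fun_prop

lemma gaussianPDF_mul_gaussianDensityRatio {v : ℝ} (hv : 0 < v) (m x : ℝ) :
    gaussianPDF 0 1 x * gaussianDensityRatio m v x = gaussianPDF m v.toNNReal x := by
  rw [gaussianPDF, gaussianPDF, gaussianDensityRatio,
    ← ENNReal.ofReal_mul (gaussianPDFReal_nonneg _ _ _)]
  congr 1
  simp only [gaussianPDFReal, Real.coe_toNNReal _ hv.le, NNReal.coe_one]
  rw [mul_mul_mul_comm, ← Real.exp_add, mul_one, Real.sqrt_mul' _ hv.le, mul_inv]
  ring_nf

lemma withDensity_gaussianDensityRatio {v : ℝ} (hv : 0 < v) (m : ℝ) :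
    (gaussianReal 0 1).withDensity (gaussianDensityRatio m v) = gaussianReal m v.toNNReal := by
  rw [gaussianReal_of_var_ne_zero 0 one_ne_zero,
    gaussianReal_of_var_ne_zero m (Real.toNNReal_pos.2 hv).ne',
    ← withDensity_mul _ (measurable_gaussianPDF 0 1) (measurable_gaussianDensityRatio m v)]
  exact congr_arg _ (funext (gaussianPDF_mul_gaussianDensityRatio hv m))

lemma lintegral_gaussianDensityRatio {v : ℝ} (hv : 0 < v) (m : ℝ) :
    ∫⁻ x, gaussianDensityRatio m v x ∂gaussianReal 0 1 = 1 := by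
  rw [← setLIntegral_univ, ← withDensity_apply _ .univ, withDensity_gaussianDensityRatio hv,
    measure_univ]

/-- The Mehler kernel: the density of the bivariate normal law with unit variances and
correlation `ρ` with respect to the standard Gaussian measure on the plane. -/
noncomputable def mehler (ρ x y : ℝ) : ℝ≥0∞ :=
  ENNReal.ofReal ((√(1 - ρ ^ 2))⁻¹ *
    Real.exp ((2 * ρ * x * y - ρ ^ 2 * (x ^ 2 + y ^ 2)) / (2 * (1 - ρ ^ 2))))

@[fun_prop]
lemma measurable_mehler {α : Type*} [MeasurableSpace α] {ρ : ℝ} {f g : α → ℝ}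
    (hf : Measurable f) (hg : Measurable g) : Measurable fun x => mehler ρ (f x) (g x) := by
  unfold mehler
  fun_prop

lemma mehler_comm (ρ x y : ℝ) : mehler ρ x y = mehler ρ y x := by
  unfold mehler
  ring_nf

lemma mehler_eq_gaussianDensityRatio {ρ : ℝ} (hρ : ρ ^ 2 < 1) (x : ℝ) :
    mehler ρ x = gaussianDensityRatio (ρ * x) (1 - ρ ^ 2) := by
  have h : 1 - ρ ^ 2 ≠ 0 := by linarith
  ext y
  unfold mehler gaussianDensityRatio
  congr 3
  field_simp
  ring

-- Complete the square in `y`.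
lemma mehler_mul_mehler {a b : ℝ} (ha : a ^ 2 < 1) (hb : b ^ 2 < 1) (x y z : ℝ) :
    mehler a x y * mehler b y z = mehler (a * b) x z *
      gaussianDensityRatio
        ((a * (1 - b ^ 2) * x + b * (1 - a ^ 2) * z) / (1 - (a * b) ^ 2))
        ((1 - a ^ 2) * (1 - b ^ 2) / (1 - (a * b) ^ 2)) y := by
  have ha' : 0 < 1 - a ^ 2 := sub_pos.2 ha
  have hb' : 0 < 1 - b ^ 2 := sub_pos.2 hb
  have hab : 0 < 1 - (a * b) ^ 2 := by nlinarith [sq_nonneg a, sq_nonneg b]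
  unfold mehler gaussianDensityRatio
  rw [← ENNReal.ofReal_mul (by positivity), ← ENNReal.ofReal_mul (by positivity),
    mul_mul_mul_comm (√(1 - a ^ 2))⁻¹, mul_mul_mul_comm (√(1 - (a * b) ^ 2))⁻¹,
    ← Real.exp_add, ← Real.exp_add]
  congr 2
  · rw [← mul_inv, ← mul_inv, ← Real.sqrt_mul ha'.le, ← Real.sqrt_mul hab.le,
      mul_div_cancel₀ _ hab.ne']
  · rw [mul_pow] at hab ⊢
    congr 1
    field_simp
    ring

lemma lintegral_mehler_mul_mehler {a b : ℝ} (ha : a ^ 2 < 1) (hb : b ^ 2 < 1) (x z : ℝ) :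
    ∫⁻ y, mehler a x y * mehler b y z ∂gaussianReal 0 1 = mehler (a * b) x z := by
  have hab : (a * b) ^ 2 < 1 := by nlinarith [sq_nonneg a, sq_nonneg b]
  simp_rw [mehler_mul_mehler ha hb]
  rw [lintegral_const_mul _ (by fun_prop), lintegral_gaussianDensityRatio, mul_one]
  exact div_pos (mul_pos (sub_pos.2 ha) (sub_pos.2 hb)) (sub_pos.2 hab)

lemma mehler_self {a : ℝ} (ha : |a| < 1) (x : ℝ) :
    mehler a x x =
      ENNReal.ofReal (1 - a)⁻¹ * gaussianDensityRatio 0 ((1 + a) / (1 - a)) x := by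
  have h1 : 0 < 1 + a := by linarith [(abs_lt.1 ha).1]
  have h2 : 0 < 1 - a := by linarith [(abs_lt.1 ha).2]
  have hsq : 1 - a ^ 2 = (1 - a) * (1 + a) := by ring
  unfold mehler gaussianDensityRatio
  rw [← ENNReal.ofReal_mul (by positivity), ← mul_assoc, hsq]
  congr 3
  · rw [← mul_inv]
    congr 1
    nth_rw 2 [← Real.sqrt_sq h2.le]
    rw [← Real.sqrt_mul (sq_nonneg _)]
    congr 1
    field_simp
  · field_simp
    ring

lemma lintegral_mehler_self {a : ℝ} (ha : |a| < 1) :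
    ∫⁻ x, mehler a x x ∂gaussianReal 0 1 = ENNReal.ofReal (1 - a)⁻¹ := by
  obtain ⟨h1, h2⟩ := abs_lt.1 ha
  simp_rw [mehler_self ha]
  rw [lintegral_const_mul _ (by fun_prop), lintegral_gaussianDensityRatio, mul_one]
  exact div_pos (by linarith) (by linarith)

end Mehler

lemma prod_decomposeFin_succ_cons {X M : Type*} [CommMonoid M] {n : ℕ}
    (f : Fin (n + 1) → X → X → M) (i : Fin n) (e : Equiv.Perm (Fin n)) (t : X) (y : Fin n → X) :
    ∏ l, f l ((Fin.cons t y : Fin (n + 1) → X) l)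
        ((Fin.cons t y : Fin (n + 1) → X) (Equiv.Perm.decomposeFin.symm ((e i).succ, e) l)) =
      f i.succ (y i) t * f 0 t (y (e i)) *
        ∏ l ∈ Finset.univ.erase i, f l.succ (y l) (y (e l)) := by
  rw [Fin.prod_univ_succ, ← Finset.mul_prod_erase _ _ (Finset.mem_univ i), ← mul_assoc]
  congr 1
  · simp [mul_comm]
  · refine Finset.prod_congr rfl fun l hl => ?_
    have hne : (e l).succ ≠ (e i).succ := fun hli =>
      (Finset.mem_erase.1 hl).1 (e.injective (Fin.succ_injective _ hli))
    rw [Equiv.Perm.decomposeFin_symm_apply_succ,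
      Equiv.swap_apply_of_ne_of_ne (Fin.succ_ne_zero _) hne, Fin.cons_succ, Fin.cons_succ]

/-- A multiplicative family of kernels on `(X, μ)`, indexed by a semigroup `A`, with prescribed
traces: `K a` composed with `K b` is `K (a * b)`, and `K a` has trace `tr a`. Two such families
with the same traces have the same integrals along permutations. -/
structure IsKernelSemigroup {A X : Type*} [Semigroup A] [MeasurableSpace X] (μ : Measure X)
    (K : A → X → X → ℝ≥0∞) (tr : A → ℝ≥0∞) : Prop where
  measurable : ∀ a, Measurable fun p : X × X => K a p.1 p.2
  comp : ∀ a b x z, ∫⁻ y, K a x y * K b y z ∂μ = K (a * b) x z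
  trace : ∀ a, ∫⁻ x, K a x x ∂μ = tr a

namespace IsKernelSemigroup

variable {A X : Type*} [Semigroup A] [MeasurableSpace X] {μ : Measure X}
  {K : A → X → X → ℝ≥0∞} {tr : A → ℝ≥0∞} {n : ℕ}

lemma measurable_apply (h : IsKernelSemigroup μ K tr) (a : A) {α : Type*} [MeasurableSpace α]
    {f g : α → X} (hf : Measurable f) (hg : Measurable g) :
    Measurable fun x => K a (f x) (g x) :=
  (h.measurable a).comp (hf.prodMk hg)

lemma measurable_prod (h : IsKernelSemigroup μ K tr) (a : Fin n → A) (σ : Fin n → Fin n) :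
    Measurable fun x : Fin n → X => ∏ i, K (a i) (x i) (x (σ i)) :=
  Finset.measurable_prod _ fun i _ =>
    h.measurable_apply (a i) (measurable_pi_apply i) (measurable_pi_apply (σ i))

variable [SigmaFinite μ]

lemma lintegral_prod_decomposeFin_zero (h : IsKernelSemigroup μ K tr) (a : Fin (n + 1) → A)
    (e : Equiv.Perm (Fin n)) :
    ∫⁻ x, ∏ i, K (a i) (x i) (x (Equiv.Perm.decomposeFin.symm (0, e) i))
        ∂Measure.pi (fun _ => μ) =
      tr (a 0) * ∫⁻ x, ∏ i, K (a i.succ) (x i) (x (e i)) ∂Measure.pi (fun _ => μ) := by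
  rw [lintegral_pi_fin_succ μ (h.measurable_prod a _),
    ← lintegral_const_mul _ (h.measurable_prod (fun i => a i.succ) e)]
  refine lintegral_congr fun y => ?_
  simp only [Fin.prod_univ_succ, Equiv.Perm.decomposeFin_symm_apply_zero,
    Equiv.Perm.decomposeFin_symm_apply_succ, Equiv.swap_self, Equiv.refl_apply, Fin.cons_zero,
    Fin.cons_succ]
  rw [lintegral_mul_const _ (h.measurable_apply _ measurable_id' measurable_id'), h.trace]

-- Integrating out `x 0` merges the two kernels of its cycle that meet there.
lemma lintegral_prod_decomposeFin_succ (h : IsKernelSemigroup μ K tr) (a : Fin (n + 1) → A)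
    (i : Fin n) (e : Equiv.Perm (Fin n)) :
    ∫⁻ x, ∏ l, K (a l) (x l) (x (Equiv.Perm.decomposeFin.symm ((e i).succ, e) l))
        ∂Measure.pi (fun _ => μ) =
      ∫⁻ x, ∏ l, K (Function.update (fun l => a l.succ) i (a i.succ * a 0) l) (x l) (x (e l))
        ∂Measure.pi (fun _ => μ) := by
  rw [lintegral_pi_fin_succ μ (h.measurable_prod a _)]
  refine lintegral_congr fun y => ?_
  have hmeas : Measurable fun t => K (a i.succ) (y i) t * K (a 0) t (y (e i)) :=
    (h.measurable_apply _ measurable_const measurable_id).mul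
      (h.measurable_apply _ measurable_id measurable_const)
  simp_rw [prod_decomposeFin_succ_cons fun l => K (a l)]
  rw [lintegral_mul_const _ hmeas, h.comp, ← Finset.mul_prod_erase _ _ (Finset.mem_univ i),
    Function.update_self]
  congr 1
  refine Finset.prod_congr rfl fun l hl => ?_
  rw [Function.update_of_ne (Finset.mem_erase.1 hl).1]

theorem lintegral_prod_perm_eq (h : IsKernelSemigroup μ K tr) {X' : Type*} [MeasurableSpace X']
    {μ' : Measure X'} [SigmaFinite μ'] {K' : A → X' → X' → ℝ≥0∞}
    (h' : IsKernelSemigroup μ' K' tr) (a : Fin n → A) (σ : Equiv.Perm (Fin n)) :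
    ∫⁻ x, ∏ i, K (a i) (x i) (x (σ i)) ∂Measure.pi (fun _ => μ) =
      ∫⁻ x, ∏ i, K' (a i) (x i) (x (σ i)) ∂Measure.pi (fun _ => μ') := by
  induction n with
  | zero => simp
  | succ n ih =>
    obtain ⟨⟨p, e⟩, rfl⟩ := Equiv.Perm.decomposeFin.symm.surjective σ
    induction p using Fin.cases with
    | zero => rw [h.lintegral_prod_decomposeFin_zero, h'.lintegral_prod_decomposeFin_zero, ih]
    | succ j =>
      obtain ⟨i, rfl⟩ := e.surjective j
      rw [h.lintegral_prod_decomposeFin_succ, h'.lintegral_prod_decomposeFin_succ, ih]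

end IsKernelSemigroup

lemma isKernelSemigroup_diagonal :
    IsKernelSemigroup Measure.count
      (fun (a : Set.Ico (0 : ℝ) 1) (k l : ℕ) => if k = l then ENNReal.ofReal a ^ k else 0)
      (fun a => ENNReal.ofReal (1 - (a : ℝ))⁻¹) where
  measurable a := measurable_of_countable _
  comp a b k l := by
    rw [lintegral_count, tsum_eq_single k fun m hm => by simp [hm.symm]]
    by_cases hkl : k = l
    · simp [hkl, mul_pow, ENNReal.ofReal_mul a.2.1]
    · simp [hkl]
  trace a := by
    simp only [lintegral_count, if_true]
    rw [ENNReal.tsum_geometric, ENNReal.ofReal_inv_of_pos (sub_pos.2 a.2.2),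
      ENNReal.ofReal_sub _ a.2.1, ENNReal.ofReal_one]

lemma isKernelSemigroup_mehler :
    IsKernelSemigroup (gaussianReal 0 1) (fun a : Set.Ico (0 : ℝ) 1 => mehler a)
      (fun a => ENNReal.ofReal (1 - (a : ℝ))⁻¹) where
  measurable a := by fun_prop
  comp a b := lintegral_mehler_mul_mehler (pow_lt_one₀ a.2.1 a.2.2 two_ne_zero)
    (pow_lt_one₀ b.2.1 b.2.2 two_ne_zero)
  trace a := lintegral_mehler_self ((abs_of_nonneg a.2.1).trans_lt a.2.2)

lemma pi_count_eq_count {ι α : Type*} [Fintype ι] [Countable α] [MeasurableSpace α]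
    [MeasurableSingletonClass α] :
    Measure.pi (fun _ : ι => (Measure.count : Measure α)) = Measure.count :=
  Measure.ext_of_singleton fun k => by simp [Measure.pi_singleton]

theorem lintegral_prod_mehler_perm {n : ℕ} {r : ℝ} (hr0 : 0 ≤ r) (hr1 : r < 1)
    (σ : Equiv.Perm (Fin n)) :
    ∫⁻ x, ∏ i, mehler r (x i) (x (σ i)) ∂Measure.pi (fun _ => gaussianReal 0 1) =
      ∑' k : Fin n → ℕ, if k ∘ σ = k then ENNReal.ofReal r ^ ∑ i, k i else 0 := by
  have h := isKernelSemigroup_mehler.lintegral_prod_perm_eq isKernelSemigroup_diagonal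
    (fun _ => ⟨r, hr0, hr1⟩) σ
  simp only [pi_count_eq_count, lintegral_count] at h
  rw [h]
  refine tsum_congr fun k => ?_
  split_ifs with hk
  · rw [← Finset.prod_pow_eq_pow_sum]
    exact Finset.prod_congr rfl fun i _ => if_pos (congr_fun hk i).symm
  · obtain ⟨i, hi⟩ := Function.ne_iff.1 hk
    exact Finset.prod_eq_zero (Finset.mem_univ i) (if_neg (Ne.symm hi))

lemma gaussianReal_zero_one_map_add_sqrt_mul {v : ℝ} (hv : 0 ≤ v) (m : ℝ) :
    (gaussianReal 0 1).map (fun y => m + √v * y) = gaussianReal m v.toNNReal := by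
  have hcomp : (fun y => m + √v * y) = (m + ·) ∘ (√v * ·) := rfl
  rw [hcomp, ← Measure.map_map (by fun_prop) (by fun_prop), gaussianReal_map_const_mul,
    gaussianReal_map_const_add]
  congr 1
  · simp
  · ext
    simp [Real.sq_sqrt hv, hv]

instance (ρ : ℝ) : IsProbabilityMeasure (pairLaw ρ) := by unfold pairLaw; infer_instance

lemma posSemidef_corrMatrix {ρ : ℝ} (hρ : ρ ^ 2 ≤ 1) : (corrMatrix ρ).PosSemidef := by
  refine Matrix.PosSemidef.of_dotProduct_mulVec_nonneg ?_ fun x => ?_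
  · ext i j
    fin_cases i <;> fin_cases j <;> simp [corrMatrix]
  · simp only [corrMatrix, Matrix.mulVec, dotProduct, Fin.sum_univ_two, Pi.star_apply, star_trivial,
      Matrix.of_apply, Matrix.cons_val_zero, Matrix.cons_val_one, Matrix.cons_val', one_mul]
    nlinarith [sq_nonneg (x 0 + ρ * x 1), mul_nonneg (sub_nonneg.2 hρ) (sq_nonneg (x 1))]

lemma charFun_pairLaw {ρ : ℝ} (hρ : ρ ^ 2 ≤ 1) (t : EuclideanSpace ℝ (Fin 2)) :
    charFun (pairLaw ρ) t =
      charFun (gaussianReal 0 1) (t 0 + ρ * t 1) *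
        charFun (gaussianReal 0 1) (√(1 - ρ ^ 2) * t 1) := by
  have hsq : ((√(1 - ρ ^ 2) : ℝ) : ℂ) ^ 2 = 1 - (ρ : ℂ) ^ 2 := by
    exact_mod_cast Real.sq_sqrt (sub_nonneg.2 hρ)
  rw [pairLaw, charFun_multivariateGaussian (posSemidef_corrMatrix hρ), charFun_gaussianReal,
    charFun_gaussianReal, ← Complex.exp_add]
  congr 1
  simp only [inner_zero_right, Complex.ofReal_zero, zero_mul, dotProduct, Matrix.mulVec, corrMatrix,
    Matrix.of_apply, Matrix.cons_val', Matrix.cons_val_fin_one, Fin.sum_univ_two,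
    Matrix.cons_val_zero, Matrix.cons_val_one, one_mul, Complex.ofReal_add, Complex.ofReal_mul,
    zero_sub, mul_zero, NNReal.coe_one, Complex.ofReal_one, mul_pow, hsq]
  ring

lemma pairLaw_eq_map {ρ : ℝ} (hρ : ρ ^ 2 ≤ 1) :
    pairLaw ρ = ((gaussianReal 0 1).prod (gaussianReal 0 1)).map
      fun p => !₂[p.1, ρ * p.1 + √(1 - ρ ^ 2) * p.2] := by
  have hmeas : Measurable fun p : ℝ × ℝ => !₂[p.1, ρ * p.1 + √(1 - ρ ^ 2) * p.2] := by
    fun_prop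
  have := Measure.isProbabilityMeasure_map
    (μ := (gaussianReal 0 1).prod (gaussianReal 0 1)) hmeas.aemeasurable
  refine Measure.ext_of_charFun (funext fun t => ?_)
  rw [charFun_pairLaw hρ, charFun_apply_real, charFun_apply_real, ← integral_prod_mul,
    charFun_apply, integral_map hmeas.aemeasurable (by fun_prop)]
  refine integral_congr_ae (.of_forall fun p => ?_)
  simp only [← Complex.exp_add, PiLp.inner_apply, Fin.sum_univ_two]
  congr 1
  simp only [Complex.ofReal_add, Complex.ofReal_mul, Matrix.cons_val_zero, RCLike.inner_apply,
    Real.ringHom_apply, Matrix.cons_val_one, Matrix.cons_val_fin_one]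
  ring

lemma pairLaw_zero_eq_map :
    pairLaw 0 = ((gaussianReal 0 1).prod (gaussianReal 0 1)).map fun p => !₂[p.1, p.2] := by
  simpa using pairLaw_eq_map (ρ := 0) (by norm_num)

lemma pairLaw_eq_withDensity {ρ : ℝ} (hρ : ρ ^ 2 < 1) :
    pairLaw ρ = (pairLaw 0).withDensity fun z => mehler ρ (z 0) (z 1) := by
  refine Measure.ext_of_lintegral _ fun f hf => ?_
  rw [lintegral_withDensity_eq_lintegral_mul _ (by fun_prop) hf, pairLaw_zero_eq_map,
    pairLaw_eq_map hρ.le, lintegral_map hf (by fun_prop), lintegral_map (by fun_prop) (by fun_prop),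
    lintegral_prod _ (by fun_prop), lintegral_prod _ (by fun_prop)]
  refine lintegral_congr fun x => ?_
  have hfx : Measurable fun y => f !₂[x, y] := by fun_prop
  calc ∫⁻ y, f !₂[x, ρ * x + √(1 - ρ ^ 2) * y] ∂gaussianReal 0 1
      = ∫⁻ y, f !₂[x, y] ∂gaussianReal (ρ * x) (1 - ρ ^ 2).toNNReal := by
        rw [← gaussianReal_zero_one_map_add_sqrt_mul (sub_nonneg.2 hρ.le),
          lintegral_map hfx (by fun_prop)]
    _ = ∫⁻ y, mehler ρ x y * f !₂[x, y] ∂gaussianReal 0 1 := by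
        rw [← withDensity_gaussianDensityRatio (sub_pos.2 hρ), ← mehler_eq_gaussianDensityRatio hρ,
          lintegral_withDensity_eq_lintegral_mul _ (by fun_prop) hfx]
        rfl

section Observations

variable {n : ℕ}

@[fun_prop]
lemma measurable_unmatch (σ : Equiv.Perm (Fin n)) : Measurable (unmatch σ) := by
  unfold unmatch
  fun_prop

lemma measurePreserving_coordinates :
    MeasurePreserving (fun z : EuclideanSpace ℝ (Fin 2) => (z 0, z 1)) (pairLaw 0)
      ((gaussianReal 0 1).prod (gaussianReal 0 1)) := by
  refine ⟨by fun_prop, ?_⟩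
  rw [pairLaw_zero_eq_map, Measure.map_map (by fun_prop) (by fun_prop)]
  exact Measure.map_id

lemma measurePreserving_unmatch (σ : Equiv.Perm (Fin n)) :
    MeasurePreserving (unmatch σ) (Measure.pi fun _ => pairLaw 0)
      ((Measure.pi fun _ => gaussianReal 0 1).prod (Measure.pi fun _ => gaussianReal 0 1)) := by
  have hpairs := measurePreserving_pi (fun _ : Fin n => pairLaw 0)
    (fun _ => (gaussianReal 0 1).prod (gaussianReal 0 1)) fun _ => measurePreserving_coordinates
  have hsplit := measurePreserving_arrowProdEquivProdArrow ℝ ℝ (Fin n)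
    (fun _ => gaussianReal 0 1) (fun _ => gaussianReal 0 1)
  have hperm := measurePreserving_piCongrLeft (α := fun _ => ℝ) (fun _ => gaussianReal 0 1) σ
  convert (((MeasurePreserving.id (Measure.pi fun _ => gaussianReal 0 1)).prod hperm).comp
    hsplit).comp hpairs using 1
  funext z
  refine Prod.ext rfl (funext fun j => ?_)
  obtain ⟨i, rfl⟩ := σ.surjective j
  simp only [Function.comp_apply, Prod.map_snd]
  rw [MeasurableEquiv.coe_piCongrLeft, Equiv.piCongrLeft_apply_apply]
  simp [unmatch, MeasurableEquiv.arrowProdEquivProdArrow]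

lemma nullLaw_eq_prod (n : ℕ) :
    nullLaw n =
      (Measure.pi fun _ => gaussianReal 0 1).prod (Measure.pi fun _ => gaussianReal 0 1) :=
  (measurePreserving_unmatch 1).map_eq

instance (n : ℕ) : IsProbabilityMeasure (nullLaw n) := by rw [nullLaw_eq_prod]; infer_instance

/-- The likelihood ratio of the alternative given the permutation `σ` against the null. -/
noncomputable def likelihoodRatioGiven (ρ : ℝ) (σ : Equiv.Perm (Fin n)) (p : Obs n) : ℝ≥0∞ :=
  ∏ i, mehler ρ (p.1 i) (p.2 (σ i))

@[fun_prop]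
lemma measurable_likelihoodRatioGiven (ρ : ℝ) (σ : Equiv.Perm (Fin n)) :
    Measurable (likelihoodRatioGiven ρ σ) := by
  unfold likelihoodRatioGiven
  fun_prop

lemma altLawGiven_eq_withDensity {ρ : ℝ} (hρ : ρ ^ 2 < 1) (σ : Equiv.Perm (Fin n)) :
    altLawGiven n ρ σ = (nullLaw n).withDensity (likelihoodRatioGiven ρ σ) := by
  have : SigmaFinite ((pairLaw 0).withDensity fun z => mehler ρ (z 0) (z 1)) := by
    rw [← pairLaw_eq_withDensity hρ]
    infer_instance
  rw [altLawGiven, pairLaw_eq_withDensity hρ, pi_withDensity fun _ => by fun_prop,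
    nullLaw_eq_prod,
    ← withDensity_comp_map (measurePreserving_unmatch σ) (measurable_likelihoodRatioGiven ρ σ)]
  congr 2
  funext z
  simp [likelihoodRatioGiven, unmatch]

/-- The likelihood ratio of the alternative against the null: the average of
`likelihoodRatioGiven ρ σ` over the permutations `σ`. -/
noncomputable def likelihoodRatio (n : ℕ) (ρ : ℝ) (p : Obs n) : ℝ≥0∞ :=
  (n.factorial : ℝ≥0∞)⁻¹ * ∑ σ : Equiv.Perm (Fin n), likelihoodRatioGiven ρ σ p

@[fun_prop]
lemma measurable_likelihoodRatio (n : ℕ) (ρ : ℝ) : Measurable (likelihoodRatio n ρ) := by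
  unfold likelihoodRatio
  fun_prop

lemma altLaw_eq_withDensity {ρ : ℝ} (hρ : ρ ^ 2 < 1) :
    altLaw n ρ = (nullLaw n).withDensity (likelihoodRatio n ρ) := by
  ext s hs
  simp only [altLaw, likelihoodRatio, altLawGiven_eq_withDensity hρ, Measure.smul_apply,
    Measure.finsetSum_apply, withDensity_apply _ hs, smul_eq_mul]
  rw [lintegral_const_mul _ (by fun_prop), lintegral_finsetSum _ (by fun_prop)]

instance (n : ℕ) (ρ : ℝ) : IsProbabilityMeasure (altLaw n ρ) where
  measure_univ := by
    have hgiven : ∀ σ, altLawGiven n ρ σ Set.univ = 1 := fun σ =>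
      (Measure.isProbabilityMeasure_map (measurable_unmatch σ).aemeasurable).measure_univ
    simp [altLaw, Measure.finsetSum_apply, hgiven, Fintype.card_perm,
      ENNReal.inv_mul_cancel, n.factorial_ne_zero]

lemma lintegral_likelihoodRatioGiven_mul {ρ : ℝ} (hρ : ρ ^ 2 < 1) (σ τ : Equiv.Perm (Fin n)) :
    ∫⁻ p, likelihoodRatioGiven ρ σ p * likelihoodRatioGiven ρ τ p ∂nullLaw n =
      ∫⁻ x, ∏ i, mehler (ρ ^ 2) (x i) (x ((τ⁻¹ * σ) i))
        ∂Measure.pi (fun _ => gaussianReal 0 1) := by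
  rw [nullLaw_eq_prod, lintegral_prod _ (by fun_prop)]
  refine lintegral_congr fun x => ?_
  calc ∫⁻ y, likelihoodRatioGiven ρ σ (x, y) * likelihoodRatioGiven ρ τ (x, y)
        ∂Measure.pi (fun _ => gaussianReal 0 1)
      = ∫⁻ y, ∏ j, mehler ρ (x (σ⁻¹ j)) (y j) * mehler ρ (y j) (x (τ⁻¹ j))
          ∂Measure.pi (fun _ => gaussianReal 0 1) := by
        refine lintegral_congr fun y => ?_
        rw [Finset.prod_mul_distrib, ← Equiv.prod_comp σ, ← Equiv.prod_comp τ fun j =>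
          mehler ρ (y j) (x (τ⁻¹ j))]
        simp [likelihoodRatioGiven, mehler_comm ρ (y _)]
    _ = ∏ j, mehler (ρ ^ 2) (x (σ⁻¹ j)) (x (τ⁻¹ j)) := by
        rw [lintegral_pi_prod (μ := fun _ => gaussianReal 0 1)
          (f := fun j t => mehler ρ (x (σ⁻¹ j)) t * mehler ρ t (x (τ⁻¹ j))) fun _ => by fun_prop]
        simp_rw [lintegral_mehler_mul_mehler hρ hρ, sq]
    _ = ∏ i, mehler (ρ ^ 2) (x i) (x ((τ⁻¹ * σ) i)) := by
        rw [← Equiv.prod_comp σ]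
        simp

lemma sum_lintegral_likelihoodRatioGiven_mul {ρ : ℝ} (hρ : ρ ^ 2 < 1) (τ : Equiv.Perm (Fin n)) :
    ∑ σ, ∫⁻ p, likelihoodRatioGiven ρ σ p * likelihoodRatioGiven ρ τ p ∂nullLaw n =
      n.factorial * ∏ j ∈ Finset.range n, (1 - ENNReal.ofReal (ρ ^ 2) ^ (j + 1))⁻¹ := by
  simp_rw [lintegral_likelihoodRatioGiven_mul hρ, lintegral_prod_mehler_perm (sq_nonneg ρ) hρ]
  refine (Equiv.sum_comp (Equiv.mulLeft τ⁻¹) fun π => ∑' k : Fin n → ℕ,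
    if k ∘ π = k then ENNReal.ofReal (ρ ^ 2) ^ ∑ i, k i else 0).trans ?_
  rw [← tsum_orderHom_pow_sum]
  exact sum_perm_tsum_ite_comp_eq_self fun k π => by simp [Equiv.sum_comp π k]

theorem lintegral_likelihoodRatio_sq (n : ℕ) {ρ : ℝ} (hρ : ρ ^ 2 < 1) :
    ∫⁻ p, likelihoodRatio n ρ p ^ 2 ∂nullLaw n =
      ∏ j ∈ Finset.range n, (1 - ENNReal.ofReal (ρ ^ 2) ^ (j + 1))⁻¹ := by
  simp_rw [likelihoodRatio, mul_pow, sq (∑ σ, likelihoodRatioGiven ρ σ _), Finset.sum_mul_sum]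
  rw [lintegral_const_mul _ (by fun_prop), lintegral_finsetSum _ (by fun_prop),
    Finset.sum_congr rfl fun σ _ => lintegral_finsetSum _ (by fun_prop), Finset.sum_comm]
  simp_rw [sum_lintegral_likelihoodRatioGiven_mul hρ, Finset.sum_const, Finset.card_univ,
    Fintype.card_perm, Fintype.card_fin, nsmul_eq_mul]
  rw [← mul_assoc, ← mul_assoc, mul_assoc (_ ^ 2), ← sq, ← mul_pow,
    ENNReal.inv_mul_cancel (by simp [n.factorial_ne_zero]) (ENNReal.natCast_ne_top _), one_pow,
    one_mul]

end Observations

section Testing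

variable {α : Type*} [MeasurableSpace α] {μ : Measure α} {f : α → ℝ≥0∞}

lemma sq_setLIntegral_le_measure_mul (hf : AEMeasurable f μ) (s : Set α) :
    (∫⁻ x in s, f x ∂μ) ^ 2 ≤ μ s * ∫⁻ x, f x ^ 2 ∂μ := by
  have hCS := ENNReal.lintegral_mul_le_Lp_mul_Lq (μ.restrict s) Real.HolderConjugate.two_two
    (f := fun _ => 1) aemeasurable_const hf.restrict
  simp only [Pi.mul_apply, one_mul, one_pow, lintegral_one, Measure.restrict_apply_univ,
    ENNReal.rpow_two] at hCS
  calc (∫⁻ x in s, f x ∂μ) ^ 2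
      ≤ (μ s ^ (1 / 2 : ℝ) * (∫⁻ x in s, f x ^ 2 ∂μ) ^ (1 / 2 : ℝ)) ^ 2 := by gcongr
    _ = μ s * ∫⁻ x in s, f x ^ 2 ∂μ := by
      rw [mul_pow, ← ENNReal.rpow_natCast, ← ENNReal.rpow_natCast, ← ENNReal.rpow_mul,
        ← ENNReal.rpow_mul]
      norm_num
    _ ≤ μ s * ∫⁻ x, f x ^ 2 ∂μ := by gcongr; exact Measure.restrict_le_self

variable {M : NNReal} {s : Set α}

lemma sq_withDensity_real_le [IsFiniteMeasure μ] (hf : AEMeasurable f μ)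
    (hM : ∫⁻ x, f x ^ 2 ∂μ ≤ M) (hs : MeasurableSet s) :
    (μ.withDensity f).real s ^ 2 ≤ μ.real s * M := by
  have h : μ.withDensity f s ^ 2 ≤ μ s * M := by
    rw [withDensity_apply _ hs]
    exact (sq_setLIntegral_le_measure_mul hf s).trans (by gcongr)
  simpa [Measure.real] using
    ENNReal.toReal_mono (ENNReal.mul_ne_top (measure_ne_top μ s) ENNReal.coe_ne_top) h

lemma inv_two_mul_le_real_add_withDensity_real_compl [IsProbabilityMeasure μ]
    [IsProbabilityMeasure (μ.withDensity f)] (hf : AEMeasurable f μ)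
    (hM : ∫⁻ x, f x ^ 2 ∂μ ≤ M) (hs : MeasurableSet s) :
    (2 * M : ℝ)⁻¹ ≤ μ.real s + (μ.withDensity f).real sᶜ := by
  have hM1 : (1 : ℝ) ≤ M := by simpa using sq_withDensity_real_le hf hM .univ
  have hsq := sq_withDensity_real_le hf hM hs
  have hq : (μ.withDensity f).real s ≤ 1 := measureReal_le_one
  rw [probReal_compl_eq_one_sub hs, inv_le_iff_one_le_mul₀ (by linarith)]
  -- The two probabilities `p`, `q` of `s` satisfy `q ^ 2 ≤ p * M`, and `1 ≤ M`, hence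
  -- `(p + 1 - q) * M ≥ q ^ 2 + 1 - q ≥ 1 / 2`.
  nlinarith [sq_nonneg ((μ.withDensity f).real s - 1 / 2)]

end Testing

lemma inv_one_sub_le_exp {x : ℝ} (hx : x < 1) : (1 - x)⁻¹ ≤ Real.exp (x / (1 - x)) := by
  have h : (1 - x)⁻¹ = x / (1 - x) + 1 := by
    have : 1 - x ≠ 0 := by linarith
    field_simp
    ring
  exact h.trans_le (Real.add_one_le_exp _)

lemma prod_inv_one_sub_pow_le_exp {r : ℝ} (hr0 : 0 ≤ r) (hr1 : r < 1) (n : ℕ) :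
    ∏ j ∈ Finset.range n, (1 - r ^ (j + 1))⁻¹ ≤ Real.exp (r / (1 - r) ^ 2) := by
  have : 0 < 1 - r := sub_pos.2 hr1
  have hpow : ∀ j, r ^ (j + 1) ≤ r := fun j => pow_le_of_le_one hr0 hr1.le j.succ_ne_zero
  have hgeom : ∑ j ∈ Finset.range n, r ^ j ≤ (1 - r)⁻¹ := by
    rw [← tsum_geometric_of_lt_one hr0 hr1]
    exact (summable_geometric_of_lt_one hr0 hr1).sum_le_tsum _ fun j _ => pow_nonneg hr0 j
  calc ∏ j ∈ Finset.range n, (1 - r ^ (j + 1))⁻¹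
      ≤ ∏ j ∈ Finset.range n, Real.exp (r ^ (j + 1) / (1 - r)) := by
        refine Finset.prod_le_prod (fun j _ => inv_nonneg.2 (by linarith [hpow j])) fun j _ => ?_
        refine (inv_one_sub_le_exp ((hpow j).trans_lt hr1)).trans ?_
        gcongr
        exact hpow j
    _ = Real.exp (r / (1 - r) * ∑ j ∈ Finset.range n, r ^ j) := by
        rw [← Real.exp_sum, Finset.mul_sum]
        exact congr_arg _ (Finset.sum_congr rfl fun j _ => by ring)
    _ ≤ Real.exp (r / (1 - r) ^ 2) := by
        rw [sq, ← div_div, div_eq_mul_inv (r / (1 - r))]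
        gcongr

variable {n : ℕ} {ρ r : ℝ}

theorem lintegral_likelihoodRatio_sq_le (hr : r < 1) (hρ : ρ ^ 2 ≤ r) :
    ∫⁻ p, likelihoodRatio n ρ p ^ 2 ∂nullLaw n ≤
      ENNReal.ofReal (Real.exp (r / (1 - r) ^ 2)) := by
  have hr0 : 0 ≤ r := (sq_nonneg ρ).trans hρ
  have hpow : ∀ j, r ^ (j + 1) < 1 := fun j => pow_lt_one₀ hr0 hr j.succ_ne_zero
  calc ∫⁻ p, likelihoodRatio n ρ p ^ 2 ∂nullLaw n
      = ∏ j ∈ Finset.range n, (1 - ENNReal.ofReal (ρ ^ 2) ^ (j + 1))⁻¹ :=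
        lintegral_likelihoodRatio_sq n (hρ.trans_lt hr)
    _ ≤ ∏ j ∈ Finset.range n, (1 - ENNReal.ofReal r ^ (j + 1))⁻¹ := by gcongr
    _ = ENNReal.ofReal (∏ j ∈ Finset.range n, (1 - r ^ (j + 1))⁻¹) := by
        rw [ENNReal.ofReal_prod_of_nonneg fun j _ => inv_nonneg.2 (sub_nonneg.2 (hpow j).le)]
        refine Finset.prod_congr rfl fun j _ => ?_
        rw [ENNReal.ofReal_inv_of_pos (sub_pos.2 (hpow j)), ENNReal.ofReal_sub _ (pow_nonneg hr0 _),
          ENNReal.ofReal_one, ENNReal.ofReal_pow hr0]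
    _ ≤ ENNReal.ofReal (Real.exp (r / (1 - r) ^ 2)) :=
        ENNReal.ofReal_le_ofReal (prod_inv_one_sub_pow_le_exp hr0 hr n)

lemma le_risk (hr : r < 1) (hρ : ρ ^ 2 ≤ r) {φ : Obs n → Fin 2} (hφ : Measurable φ) :
    (2 * Real.exp (r / (1 - r) ^ 2))⁻¹ ≤ risk n ρ φ := by
  have hdens := altLaw_eq_withDensity (n := n) (hρ.trans_lt hr)
  have hprob : IsProbabilityMeasure ((nullLaw n).withDensity (likelihoodRatio n ρ)) := by
    rw [← hdens]
    infer_instance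
  have hcompl : {p | φ p = 0} = {p | φ p = 1}ᶜ := by
    ext p
    simp only [Set.mem_ofPred_eq, Set.mem_compl_iff]
    omega
  rw [risk, hcompl, hdens]
  have hrisk := inv_two_mul_le_real_add_withDensity_real_compl (by fun_prop)
    (lintegral_likelihoodRatio_sq_le hr hρ) (hφ (measurableSet_singleton 1))
  rwa [Real.coe_toNNReal _ (Real.exp_nonneg _)] at hrisk

theorem le_bayesRisk (hr : r < 1) (hρ : ρ ^ 2 ≤ r) :
    (2 * Real.exp (r / (1 - r) ^ 2))⁻¹ ≤ bayesRisk n ρ := by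
  have : Nonempty {φ : Obs n → Fin 2 // Measurable φ} := ⟨⟨fun _ => 0, measurable_const⟩⟩
  exact le_ciInf fun φ => le_risk hr hρ φ.2

end PermutedCorrelation

theorem theorem1 (ρ : ℕ → ℝ) (n : ℕ → ℕ) (hρ : ∀ k, |ρ k| ≤ 1)
    (hΩ : PermutedCorrelation.IsBigOmega (fun k => 1 - ρ k ^ 2) (fun _ => 1)) :
    PermutedCorrelation.IsBigOmega
        (fun k => PermutedCorrelation.bayesRisk (n k) (ρ k)) (fun _ => 1) ∧
      ¬ PermutedCorrelation.StrongDetection ρ n := by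
  obtain ⟨C, hC, hCρ⟩ := hΩ
  set r := 1 - C⁻¹
  have hr : r < 1 := sub_lt_self _ (inv_pos.2 hC)
  have hρr : ∀ k, ρ k ^ 2 ≤ r := fun k => by
    linarith [(inv_le_iff_one_le_mul₀' hC).2 (hCρ k)]
  have hbound := fun k => PermutedCorrelation.le_bayesRisk (n := n k) hr (hρr k)
  set M := 2 * Real.exp (r / (1 - r) ^ 2)
  have hM : 0 < M := by positivity
  refine ⟨⟨M, hM, fun k => (inv_le_iff_one_le_mul₀' hM).1 (hbound k)⟩, fun hlim => ?_⟩
  exact (inv_pos.2 hM).not_ge (ge_of_tendsto' hlim hbound)
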